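/- Let $X$ be a connected, locally connected, locally compact, paracompact Hausdorff space and let $\pi\colon E\to X$ be a locally trivial real vector bundle of finite rank $n$. Let $\mathrm{Gau}(E)$ be the group, under composition, of all homeomorphisms $\phi\colon E\to E$ such that $\pi\circ\phi=\pi$ and such that $\phi$ restricts to a linear isomorphism on each fibre, with the subspace topology of $\mathrm{Map}(E,E)$, the space of continuous maps $E\to E$ with the compact-open topology. Let $\mathrm{Gau}_0(E)$ be the path component of the identity in $\mathrm{Gau}(E)$; it is a subgroup. Let $\mathcal Q(E)$ be the set of continuous functions $q\colon E\to\mathbb R$ whose restriction to each fibre $E_x=\pi^{-1}(x)$ is a non-degenerate quadratic form (that is, the associated symmetric bilinear form on $E_x$ is non-degenerate), with the subspace topology of $\mathrm{Map}(E,\mathbb R)$, the space of continuous functions $E\to\mathbb R$ with the compact-open topology. The group $\mathrm{Gau}(E)$ acts on $\mathcal Q(E)$ from the right by $(q,\phi)\mapsto q\circ\phi$. Then the orbits of $\mathrm{Gau}_0(E)$ on $\mathcal Q(E)$ are precisely the path components of $\mathcal Q(E)$: for every $q\in\mathcal Q(E)$ the $\mathrm{Gau}_0(E)$-orbit of $q$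 is the path component of $q$. Moreover, every $\mathrm{Gau}(E)$-orbit in $\mathcal Q(E)$ is a disjoint union of path components of $\mathcal Q(E)$. -/

import Mathlib

open Bundle

section GaugeGroup

variable {X : Type*} (F : Type*) (E : X → Type*) [TopologicalSpace (TotalSpace F E)]
  [∀ x, AddCommGroup (E x)] [∀ x, Module ℝ (E x)]

/-- The gauge group of `E`: the homeomorphisms `φ` of the total space that cover the identity of the
base and restrict to linear isomorphisms `L x : E x ≃ₗ[ℝ] E x` on the fibres. The group law is
composition. -/
def Gau : Subgroup (TotalSpace F E ≃ₜ TotalSpace F E) where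
  carrier := {φ | ∃ L : ∀ x, E x ≃ₗ[ℝ] E x, ∀ (x : X) (v : E x), φ ⟨x, v⟩ = ⟨x, L x v⟩}
  one_mem' := ⟨fun x => LinearEquiv.refl ℝ (E x), fun _ _ => rfl⟩
  mul_mem' := by
    rintro φ ψ ⟨L, hL⟩ ⟨M, hM⟩
    refine ⟨fun x => (M x).trans (L x), fun x v => ?_⟩
    change φ (ψ ⟨x, v⟩) = _
    rw [hM, hL]
    rfl
  inv_mem' := by
    rintro φ ⟨L, hL⟩
    refine ⟨fun x => (L x).symm, fun x v => ?_⟩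
    change φ.symm ⟨x, v⟩ = _
    rw [Homeomorph.symm_apply_eq, hL, LinearEquiv.apply_symm_apply]

variable {F E} in
/-- A gauge transformation, as a continuous map from the total space to itself. -/
def gauToContinuousMap (φ : Gau F E) : C(TotalSpace F E, TotalSpace F E) :=
  ⟨φ.1, φ.1.continuous⟩

/-- The gauge group carries the subspace topology of the space of continuous self-maps of the total
space with the compact-open topology. -/
instance Gau.instTopologicalSpace : TopologicalSpace (Gau F E) :=
  TopologicalSpace.induced gauToContinuousMap ContinuousMap.compactOpen

theorem Gau.continuous_mul_left (φ : Gau F E) : Continuous fun ψ : Gau F E => φ * ψ :=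
  continuous_induced_rng.2 <|
    (ContinuousMap.continuous_postcomp (gauToContinuousMap φ)).comp
      (continuous_induced_dom (f := gauToContinuousMap (F := F) (E := E)))

theorem Gau.continuous_mul_right (φ : Gau F E) : Continuous fun ψ : Gau F E => ψ * φ :=
  continuous_induced_rng.2 <|
    (ContinuousMap.continuous_precomp (gauToContinuousMap φ)).comp
      (continuous_induced_dom (f := gauToContinuousMap (F := F) (E := E)))

/-- `Gau₀(E)`: the path component of the identity in the gauge group. -/
def GauZero : Subgroup (Gau F E) where
  carrier := pathComponent 1
  one_mem' := mem_pathComponent_self 1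
  mul_mem' := by
    intro φ ψ hφ hψ
    have h : Joined (φ * 1) (φ * ψ) := hψ.map (Gau.continuous_mul_left F E φ)
    rw [mul_one] at h
    exact Joined.trans hφ h
  inv_mem' := by
    intro φ hφ
    have h : Joined (φ⁻¹ * 1) (φ⁻¹ * φ) := hφ.map (Gau.continuous_mul_left F E φ⁻¹)
    rw [mul_one, inv_mul_cancel] at h
    exact h.symm

/-- The space of non-degenerate quadratic forms on `E`: continuous functions on the total space that
restrict to a non-degenerate quadratic form on every fibre, with the subspace topology of
the compact-open topology on the space of continuous real functions on the total space. -/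
def QuadNondeg : Type _ :=
  {q : C(TotalSpace F E, ℝ) // ∀ x : X, ∃ Q : QuadraticForm ℝ (E x),
    (∀ v : E x, q ⟨x, v⟩ = Q v) ∧ (QuadraticMap.associated (R := ℝ) Q).Nondegenerate}

instance QuadNondeg.instTopologicalSpace : TopologicalSpace (QuadNondeg F E) :=
  inferInstanceAs (TopologicalSpace {q : C(TotalSpace F E, ℝ) // ∀ x : X,
    ∃ Q : QuadraticForm ℝ (E x), (∀ v : E x, q ⟨x, v⟩ = Q v) ∧
      (QuadraticMap.associated (R := ℝ) Q).Nondegenerate})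

variable {F E} in
/-- The pullback `q ∘ φ` of a non-degenerate quadratic form along a gauge transformation. -/
def QuadNondeg.pullback (φ : Gau F E) (q : QuadNondeg F E) : QuadNondeg F E :=
  ⟨q.1.comp (gauToContinuousMap φ), by
    intro x
    obtain ⟨L, hL⟩ := φ.2
    obtain ⟨Q, hQ, hnd⟩ := q.2 x
    refine ⟨Q.comp (L x : E x →ₗ[ℝ] E x), fun v => ?_, ?_⟩
    · change q.1 (φ.1 ⟨x, v⟩) = _
      rw [hL, hQ]
      rfl
    · rw [QuadraticMap.associated_comp]
      exact hnd.congr (L x).symm (L x).symm⟩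

/-- The natural right action of the gauge group on the non-degenerate quadratic forms, by
`q ↦ q ∘ φ`. -/
instance QuadNondeg.instMulAction : MulAction (Gau F E)ᵐᵒᵖ (QuadNondeg F E) where
  smul φ q := QuadNondeg.pullback φ.unop q
  one_smul _ := rfl
  mul_smul _ _ _ := rfl

end GaugeGroup

/-! ### Square roots near `1` in a Banach algebra. -/

section SquareRoot

open Topology

/-! The heart is to lift a path `γ` of forms to a path of gauge transformations starting at `1`. If
`b'` is close to a non-degenerate `b`, then `R = b⁻¹b'` is close to `1`; its binomial square root
`S` is `b`-self-adjoint, so `b(Sv, Sw) = b(Rv, w) = b'(v, w)`. Subdividing the time interval and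
multiplying such roots pulls `γ 0` back to `γ t` (`formChain_isometry`).

To do this on all fibres at once, the construction must not depend on the trivialization: the root
commutes with conjugation (`map_sqrtSeries`). The admissible step width depends on the point, but it
is locally constant by compactness of `[0, 1]`, and a partition of unity makes it a continuous
function on `X` (`exists_continuous_isStepWidth`). The jumping number of factors is harmless because
surplus factors are `1`. Hence the products form a continuous family of fibre automorphisms, and
currying gives `exists_continuous_gau`.

Thus `Gau₀`-orbits are path components, and a `Gau`-orbit is a union of `Gau₀`-orbits. -/

theorem catalan_le_four_pow (n : ℕ) : catalan n ≤ 4 ^ n := by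
  rw [catalan_eq_centralBinom_div]
  refine (Nat.div_le_self _ _).trans ?_
  rw [Nat.centralBinom, show 4 = 2 ^ 2 by norm_num, ← pow_mul]
  exact Nat.choose_le_two_pow _ _

variable {A : Type*} [NormedRing A] [NormedAlgebra ℝ A]

/-- The series `∑ Cₙ xⁿ⁺¹`, with `Cₙ` the Catalan numbers; it solves `T = x + T²`. -/
noncomputable def catalanSeries (x : A) : A := ∑' n : ℕ, (catalan n : ℝ) • x ^ (n + 1)

/-- The binomial series of the square root, centred at `1`. -/
noncomputable def sqrtSeries (a : A) : A := 1 - (2 : ℝ) • catalanSeries ((1 / 4 : ℝ) • (1 - a))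

theorem norm_catalanSeries_term_le (x : A) (n : ℕ) :
    ‖(catalan n : ℝ) • x ^ (n + 1)‖ ≤ (4 * ‖x‖) ^ (n + 1) := by
  rw [norm_smul, mul_pow, Real.norm_natCast]
  have h : (catalan n : ℝ) ≤ 4 ^ (n + 1) := by
    have h₁ : (catalan n : ℝ) ≤ 4 ^ n := mod_cast catalan_le_four_pow n
    exact h₁.trans (pow_le_pow_right₀ (by norm_num) n.le_succ)
  exact mul_le_mul h (norm_pow_le' x n.succ_pos) (norm_nonneg _) (by positivity)

theorem summable_norm_catalanSeries {x : A} (hx : 4 * ‖x‖ < 1) :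
    Summable fun n : ℕ => ‖(catalan n : ℝ) • x ^ (n + 1)‖ :=
  Summable.of_nonneg_of_le (fun _ => norm_nonneg _) (norm_catalanSeries_term_le x)
    ((summable_nat_add_iff 1).2 (summable_geometric_of_lt_one (by positivity) hx))

/-- The Cauchy product turns the Catalan recursion into the quadratic equation. -/
theorem catalanSeries_eq [CompleteSpace A] {x : A} (hx : 4 * ‖x‖ < 1) :
    catalanSeries x = x + catalanSeries x * catalanSeries x := by
  have hs := summable_norm_catalanSeries hx
  have hmul : catalanSeries x * catalanSeries x
      = ∑' n : ℕ, (catalan (n + 1) : ℝ) • x ^ (n + 1 + 1) := by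
    unfold catalanSeries
    rw [tsum_mul_tsum_eq_tsum_sum_antidiagonal_of_summable_norm hs hs]
    refine tsum_congr fun n => ?_
    rw [catalan_succ', Nat.cast_sum, Finset.sum_smul]
    refine Finset.sum_congr rfl fun p hp => ?_
    rw [smul_mul_smul_comm, ← pow_add, ← Finset.HasAntidiagonal.mem_antidiagonal.1 hp, Nat.cast_mul]
    congr 2
    ring
  rw [hmul, catalanSeries, hs.of_norm.tsum_eq_zero_add]
  simp

theorem norm_quarter_smul (y : A) : 4 * ‖(1 / 4 : ℝ) • y‖ = ‖y‖ := by
  rw [norm_smul]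
  norm_num
  ring

/-- If `T = x + T²`, then `(1 - 2T)² = 1 - 4x`, which is `a` for `x = (1 - a)/4`. -/
theorem sqrtSeries_mul_self_of_norm_lt [CompleteSpace A] {a : A} (ha : ‖1 - a‖ < 1) :
    sqrtSeries a * sqrtSeries a = a := by
  have h := catalanSeries_eq (x := (1 / 4 : ℝ) • (1 - a)) (by rwa [norm_quarter_smul])
  unfold sqrtSeries
  set T := catalanSeries ((1 / 4 : ℝ) • (1 - a))
  have h' : T * T = T - (1 / 4 : ℝ) • (1 - a) := by
    rw [eq_sub_iff_add_eq, add_comm]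
    exact h.symm
  simp only [sub_mul, mul_sub, one_mul, mul_one, smul_mul_assoc, mul_smul_comm, h']
  module

theorem continuousAt_sqrtSeries_of_norm_lt [CompleteSpace A] {a : A} (ha : ‖1 - a‖ < 1) :
    ContinuousAt sqrtSeries a := by
  obtain ⟨r, har, hr⟩ := exists_between ha
  have hr0 : 0 ≤ r := (norm_nonneg _).trans har.le
  have hU : IsOpen {b : A | ‖1 - b‖ < r} := isOpen_lt (by fun_prop) continuous_const
  have hc : ContinuousOn (fun b : A => catalanSeries ((1 / 4 : ℝ) • (1 - b)))
      {b : A | ‖1 - b‖ < r} := by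
    unfold catalanSeries
    refine continuousOn_tsum (u := fun n : ℕ => r ^ (n + 1)) (fun n => by fun_prop)
      ((summable_nat_add_iff 1).2 (summable_geometric_of_lt_one hr0 hr)) fun n b hb => ?_
    refine (norm_catalanSeries_term_le _ n).trans ?_
    rw [norm_quarter_smul]
    exact pow_le_pow_left₀ (norm_nonneg _) (le_of_lt hb) _
  exact continuousAt_const.sub ((hc.continuousAt (hU.mem_nhds har)).const_smul _)

theorem sqrtSeries_one : sqrtSeries (1 : A) = 1 := by
  simp [sqrtSeries, catalanSeries]

/-- No convergence is needed: an isomorphism preserves summability both ways, and divergent sums are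
`0` on both sides. -/
theorem map_sqrtSeries {B : Type*} [NormedRing B] [NormedAlgebra ℝ B] (φ : A ≃A[ℝ] B) (a : A) :
    φ (sqrtSeries a) = sqrtSeries (φ a) := by
  have h : φ (catalanSeries ((1 / 4 : ℝ) • (1 - a)))
      = catalanSeries ((1 / 4 : ℝ) • (1 - φ a)) := by
    unfold catalanSeries
    refine (φ.toContinuousLinearEquiv.map_tsum).trans (tsum_congr fun n => ?_)
    change φ _ = _
    simp
  rw [sqrtSeries, map_sub, map_smul, h, map_one, sqrtSeries]

/-- A continuous linear map that kills all powers of `1 - a` kills the square root of `a`. -/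
theorem map_sqrtSeries_eq_zero {G : Type*} [NormedAddCommGroup G] [NormedSpace ℝ G] (l : A →L[ℝ] G)
    {a : A} (h : ∀ n, l ((1 - a) ^ n) = 0) : l (sqrtSeries a) = 0 := by
  have h1 : l 1 = 0 := by simpa using h 0
  have h2 : l (catalanSeries ((1 / 4 : ℝ) • (1 - a))) = 0 := by
    unfold catalanSeries
    by_cases hs : Summable fun n : ℕ => (catalan n : ℝ) • ((1 / 4 : ℝ) • (1 - a)) ^ (n + 1)
    · rw [l.map_tsum hs]
      simp [smul_pow, h]
    · rw [tsum_eq_zero_of_not_summable hs, map_zero]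
  rw [sqrtSeries, map_sub, map_smul, h1, h2, smul_zero, sub_zero]

variable (A) in
/-- The elements that an automorphism moves into the domain of convergence of `sqrtSeries`. -/
def sqrtDomain : Set A := {a | ∃ φ : A ≃A[ℝ] A, ‖1 - φ a‖ < 1}

theorem mem_sqrtDomain_of_norm_lt {a : A} (h : ‖1 - a‖ < 1) : a ∈ sqrtDomain A :=
  ⟨ContinuousAlgEquiv.refl ℝ A, h⟩

theorem map_mem_sqrtDomain {a : A} (ψ : A ≃A[ℝ] A) (h : a ∈ sqrtDomain A) :
    ψ a ∈ sqrtDomain A := by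
  obtain ⟨φ, hφ⟩ := h
  exact ⟨ψ.symm.trans φ, by simpa using hφ⟩

theorem sqrtSeries_mul_self [CompleteSpace A] {a : A} (ha : a ∈ sqrtDomain A) :
    sqrtSeries a * sqrtSeries a = a := by
  obtain ⟨φ, hφ⟩ := ha
  apply φ.injective
  change φ _ = φ _
  rw [map_mul, map_sqrtSeries]
  exact sqrtSeries_mul_self_of_norm_lt hφ

theorem continuousAt_sqrtSeries [CompleteSpace A] {a : A} (ha : a ∈ sqrtDomain A) :
    ContinuousAt sqrtSeries a := by
  obtain ⟨φ, hφ⟩ := ha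
  have h : (sqrtSeries : A → A) = φ.symm ∘ sqrtSeries ∘ φ := by
    funext b
    simp [← map_sqrtSeries]
  rw [h]
  exact φ.symm.continuous.continuousAt.comp
    ((continuousAt_sqrtSeries_of_norm_lt hφ).comp φ.continuous.continuousAt)

end SquareRoot

/-! ### Pulling one bilinear form back to another, and chains of such steps. -/

section Forms

open Topology Filter

variable {F : Type*} [NormedAddCommGroup F] [NormedSpace ℝ F]

/-- The endomorphism `B` with `b (B v) w = b' v w`, for an invertible bilinear form `b`. -/
noncomputable def formRatio (b b' : F →L[ℝ] F →L[ℝ] ℝ) : F →L[ℝ] F := b.inverse ∘L b'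

/-- The square root of `formRatio b b'`, which pulls `b` back to `b'` when `b'` is near `b`. -/
noncomputable def formStep (b b' : F →L[ℝ] F →L[ℝ] ℝ) : F →L[ℝ] F := sqrtSeries (formRatio b b')

/-- Transport of a bilinear form along a linear equivalence. -/
noncomputable def formCongr (c : F ≃L[ℝ] F) (b : F →L[ℝ] F →L[ℝ] ℝ) : F →L[ℝ] F →L[ℝ] ℝ :=
  c.arrowCongr (c.arrowCongr (ContinuousLinearEquiv.refl ℝ ℝ)) b

theorem formCongr_apply (c : F ≃L[ℝ] F) (b : F →L[ℝ] F →L[ℝ] ℝ) (v w : F) :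
    formCongr c b v w = b (c.symm v) (c.symm w) := rfl

theorem apply_formRatio {b : F →L[ℝ] F →L[ℝ] ℝ} (hb : b.IsInvertible)
    (b' : F →L[ℝ] F →L[ℝ] ℝ) (v : F) : b (formRatio b b' v) = b' v := by
  obtain ⟨e, rfl⟩ := hb
  simp [formRatio]

theorem formRatio_self {b : F →L[ℝ] F →L[ℝ] ℝ} (hb : b.IsInvertible) : formRatio b b = 1 := by
  obtain ⟨e, rfl⟩ := hb
  ext v
  simp [formRatio]

theorem formStep_self {b : F →L[ℝ] F →L[ℝ] ℝ} (hb : b.IsInvertible) : formStep b b = 1 := by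
  rw [formStep, formRatio_self hb, sqrtSeries_one]

theorem isInvertible_formCongr (c : F ≃L[ℝ] F) {b : F →L[ℝ] F →L[ℝ] ℝ} (hb : b.IsInvertible) :
    (formCongr c b).IsInvertible := by
  obtain ⟨e, rfl⟩ := hb
  exact ⟨(c.symm.trans e).trans (c.arrowCongr (ContinuousLinearEquiv.refl ℝ ℝ)), rfl⟩

theorem formRatio_formCongr (c : F ≃L[ℝ] F) {b : F →L[ℝ] F →L[ℝ] ℝ} (hb : b.IsInvertible)
    (b' : F →L[ℝ] F →L[ℝ] ℝ) :
    formRatio (formCongr c b) (formCongr c b') = c.conjContinuousAlgEquiv (formRatio b b') := by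
  have hc := isInvertible_formCongr c hb
  ext v
  apply hc.injective
  rw [apply_formRatio hc]
  ext w
  rw [formCongr_apply, formCongr_apply, ContinuousLinearEquiv.conjContinuousAlgEquiv_apply_apply,
    c.symm_apply_apply, apply_formRatio hb]

theorem formStep_formCongr (c : F ≃L[ℝ] F) {b : F →L[ℝ] F →L[ℝ] ℝ} (hb : b.IsInvertible)
    (b' : F →L[ℝ] F →L[ℝ] ℝ) :
    formStep (formCongr c b) (formCongr c b') = c.conjContinuousAlgEquiv (formStep b b') := by
  rw [formStep, formRatio_formCongr c hb, formStep, map_sqrtSeries]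

theorem formStep_selfAdjoint {b b' : F →L[ℝ] F →L[ℝ] ℝ} (hb : b.IsInvertible)
    (hs : ∀ v w, b v w = b w v) (hs' : ∀ v w, b' v w = b' w v) (v w : F) :
    b (formStep b b' v) w = b v (formStep b b' w) := by
  have h₁ : ∀ v w, b ((1 - formRatio b b') v) w = b v ((1 - formRatio b b') w) := by
    intro v w
    simp only [sub_apply, one_apply_eq_self, map_sub]
    rw [hs v (formRatio b b' w), apply_formRatio hb, apply_formRatio hb, hs' v w]
  have h : ∀ (n : ℕ) (v w : F), b (((1 - formRatio b b') ^ n : F →L[ℝ] F) v) w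
      = b v (((1 - formRatio b b') ^ n : F →L[ℝ] F) w) := by
    intro n
    induction n with
    | zero => intro v w; simp
    | succ n ih =>
      intro v w
      rw [pow_succ, mul_apply_eq_comp, ih, h₁, ← mul_apply_eq_comp, ← pow_succ', pow_succ]
  -- `l` measures the failure of self-adjointness at `v, w`; it vanishes on all powers of `1 -
  -- formRatio b b'`.
  let l : (F →L[ℝ] F) →L[ℝ] ℝ :=
    (ContinuousLinearMap.apply ℝ ℝ w ∘L b) ∘L ContinuousLinearMap.apply ℝ F v -
      b v ∘L ContinuousLinearMap.apply ℝ F w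
  have hl : ∀ T : F →L[ℝ] F, l T = b (T v) w - b v (T w) := fun T => rfl
  rw [← sub_eq_zero, ← hl]
  exact map_sqrtSeries_eq_zero l fun n => by rw [hl, h, sub_self]

theorem formStep_isometry [CompleteSpace F] {b b' : F →L[ℝ] F →L[ℝ] ℝ} (hb : b.IsInvertible)
    (hs : ∀ v w, b v w = b w v) (hs' : ∀ v w, b' v w = b' w v)
    (hd : formRatio b b' ∈ sqrtDomain (F →L[ℝ] F)) (v w : F) :
    b (formStep b b' v) (formStep b b' w) = b' v w := by
  rw [← formStep_selfAdjoint hb hs hs', ← mul_apply_eq_comp, formStep,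
    sqrtSeries_mul_self hd, apply_formRatio hb]

theorem continuousAt_formRatio [CompleteSpace F] {Y : Type*} [TopologicalSpace Y]
    {f g : Y → F →L[ℝ] F →L[ℝ] ℝ} {y : Y} (hf : ContinuousAt f y) (hg : ContinuousAt g y)
    (hb : (f y).IsInvertible) : ContinuousAt (fun z => formRatio (f z) (g z)) y :=
  (ContinuousAt.comp (f := f) (hb.contDiffAt_map_inverse (n := 0)).continuousAt hf).clm_comp hg

theorem continuousAt_formStep [CompleteSpace F] {Y : Type*} [TopologicalSpace Y]
    {f g : Y → F →L[ℝ] F →L[ℝ] ℝ} {y : Y} (hf : ContinuousAt f y) (hg : ContinuousAt g y)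
    (hb : (f y).IsInvertible) (hd : formRatio (f y) (g y) ∈ sqrtDomain (F →L[ℝ] F)) :
    ContinuousAt (fun z => formStep (f z) (g z)) y :=
  ContinuousAt.comp (f := fun z => formRatio (f z) (g z)) (continuousAt_sqrtSeries hd)
    (continuousAt_formRatio hf hg hb)

/-- The product of the `formStep`s along the points `min (k * δ) t`, `k ≤ n`, of a path of forms. -/
noncomputable def formChain (β : ℝ → F →L[ℝ] F →L[ℝ] ℝ) (δ t : ℝ) : ℕ → F →L[ℝ] F
  | 0 => 1
  | n + 1 => formChain β δ t n * formStep (β (min (n * δ) t)) (β (min ((n + 1 : ℕ) * δ) t))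

theorem formChain_formCongr (c : F ≃L[ℝ] F) {β : ℝ → F →L[ℝ] F →L[ℝ] ℝ}
    (hβ : ∀ s, (β s).IsInvertible) (δ t : ℝ) (n : ℕ) :
    formChain (fun s => formCongr c (β s)) δ t n
      = c.conjContinuousAlgEquiv (formChain β δ t n) := by
  induction n with
  | zero => simp [formChain]
  | succ n ih => rw [formChain, ih, formStep_formCongr c (hβ _), formChain, map_mul]

theorem formChain_zero {β : ℝ → F →L[ℝ] F →L[ℝ] ℝ} (hβ : ∀ s, (β s).IsInvertible) {δ : ℝ}
    (hδ : 0 ≤ δ) (n : ℕ) : formChain β δ 0 n = 1 := by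
  induction n with
  | zero => rfl
  | succ n ih =>
    rw [formChain, ih, min_eq_right (by positivity), min_eq_right (by positivity),
      formStep_self (hβ _), one_mul]

/-- Past time `t` both endpoints of a step are clamped to `t`, so its factor is `1`. -/
theorem formChain_eq_of_le {β : ℝ → F →L[ℝ] F →L[ℝ] ℝ} (hβ : ∀ s, (β s).IsInvertible) {δ t : ℝ}
    (hδ : 0 ≤ δ) {m n : ℕ} (hm : t ≤ m * δ) (hmn : m ≤ n) :
    formChain β δ t n = formChain β δ t m := by
  induction n, hmn using Nat.le_induction with
  | base => rfl
  | succ n hmn ih =>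
    have h₁ : t ≤ n * δ := hm.trans (by gcongr)
    have h₂ : t ≤ (n + 1 : ℕ) * δ := h₁.trans (by gcongr; omega)
    rw [formChain, ih, min_eq_right h₁, min_eq_right h₂, formStep_self (hβ _), mul_one]

/-- `δ` is a step width for the path of forms `β` on the unit interval. -/
def IsStepWidth (β : ℝ → F →L[ℝ] F →L[ℝ] ℝ) (δ : ℝ) : Prop :=
  0 < δ ∧ ∀ s ∈ Set.Icc (0 : ℝ) 1, ∀ u ∈ Set.Icc (0 : ℝ) δ,
    formRatio (β s) (β (s + u)) ∈ sqrtDomain (F →L[ℝ] F)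

theorem IsStepWidth.mem_sqrtDomain {β : ℝ → F →L[ℝ] F →L[ℝ] ℝ} {δ t : ℝ} (h : IsStepWidth β δ)
    (ht : t ∈ Set.Icc (0 : ℝ) 1) (n : ℕ) :
    formRatio (β (min (n * δ) t)) (β (min ((n + 1 : ℕ) * δ) t)) ∈ sqrtDomain (F →L[ℝ] F) := by
  have hδ := h.1
  have h0 : 0 ≤ n * δ := by positivity
  have key := h.2 (min (n * δ) t) ⟨le_min h0 ht.1, (min_le_right _ _).trans ht.2⟩
    (min ((n + 1 : ℕ) * δ) t - min (n * δ) t) ?_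
  · simpa using key
  · push_cast
    rw [add_mul, one_mul]
    constructor
    · rw [sub_nonneg]
      gcongr
      linarith
    · rcases le_total (n * δ) t with h' | h'
      · rw [min_eq_left h']
        linarith [min_le_left (n * δ + δ) t]
      · rw [min_eq_right h', min_eq_right (by linarith)]
        linarith

theorem formChain_isometry [CompleteSpace F] {β : ℝ → F →L[ℝ] F →L[ℝ] ℝ}
    (hβ : ∀ s, (β s).IsInvertible) (hs : ∀ s v w, β s v w = β s w v) {δ t : ℝ}
    (hδ : IsStepWidth β δ) (ht : t ∈ Set.Icc (0 : ℝ) 1) (n : ℕ) (v w : F) :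
    β 0 (formChain β δ t n v) (formChain β δ t n w) = β (min (n * δ) t) v w := by
  induction n generalizing v w with
  | zero => simp [formChain, ht.1]
  | succ n ih =>
    rw [formChain, mul_apply_eq_comp, mul_apply_eq_comp, ih]
    exact formStep_isometry (hβ _) (hs _) (hs _) (hδ.mem_sqrtDomain ht n) v w

theorem continuousAt_formChain [CompleteSpace F] {Y : Type*} [TopologicalSpace Y]
    {β : Y → ℝ → F →L[ℝ] F →L[ℝ] ℝ} {δ t : Y → ℝ} {y : Y}
    (hβc : ∀ s, ContinuousAt (fun p : Y × ℝ => β p.1 p.2) (y, s))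
    (hδc : ContinuousAt δ y) (htc : ContinuousAt t y) (hβ : ∀ s, (β y s).IsInvertible)
    (hδ : IsStepWidth (β y) (δ y)) (ht : t y ∈ Set.Icc (0 : ℝ) 1) (n : ℕ) :
    ContinuousAt (fun z => formChain (β z) (δ z) (t z) n) y := by
  have h : ∀ k : ℕ, ContinuousAt (fun z => β z (min (k * δ z) (t z))) y := fun k =>
    ContinuousAt.comp (f := fun z => (z, min (k * δ z) (t z))) (hβc _)
      (continuousAt_id.prodMk ((continuousAt_const.mul hδc).min htc))
  induction n with
  | zero => exact continuousAt_const
  | succ n ih =>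
    exact ih.mul (continuousAt_formStep (h n) (h (n + 1)) (hβ _) (hδ.mem_sqrtDomain ht n))

theorem one_le_ceil_mul {δ : ℝ} (hδ : 0 < δ) : 1 ≤ (⌈1 / δ⌉₊ : ℝ) * δ :=
  (div_le_iff₀ hδ).1 (Nat.le_ceil _)

/-- Although its number of factors is only locally bounded, the full product is continuous. -/
theorem continuousAt_formChain_ceil [CompleteSpace F] {Y : Type*} [TopologicalSpace Y]
    {β : Y → ℝ → F →L[ℝ] F →L[ℝ] ℝ} {δ t : Y → ℝ} {y : Y}
    (hβc : ∀ s, ContinuousAt (fun p : Y × ℝ => β p.1 p.2) (y, s))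
    (hδc : ContinuousAt δ y) (htc : ContinuousAt t y) (hβ : ∀ z s, (β z s).IsInvertible)
    (hδ : ∀ z, IsStepWidth (β z) (δ z)) (ht : ∀ z, t z ∈ Set.Icc (0 : ℝ) 1) :
    ContinuousAt (fun z => formChain (β z) (δ z) (t z) ⌈1 / δ z⌉₊) y := by
  obtain ⟨N, hN⟩ := exists_nat_gt (1 / δ y)
  have hN' : 1 < N * δ y := (div_lt_iff₀ (hδ y).1).1 hN
  -- Since `N * δ > 1` persists near `y`, the fixed length `N` gives the same product there; both
  -- lengths are compared with their maximum.
  refine (continuousAt_formChain hβc hδc htc (hβ y) (hδ y) (ht y) N).congr ?_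
  filter_upwards [(continuousAt_const.mul hδc).eventually_const_lt hN'] with z hz
  have h₀ := (hδ z).1.le
  rw [← formChain_eq_of_le (hβ z) h₀ ((ht z).2.trans (one_le_ceil_mul (hδ z).1)) (le_max_left _ N),
    formChain_eq_of_le (hβ z) h₀ ((ht z).2.trans hz.le) (le_max_right _ _)]

end Forms

/-! ### From continuous families of fibre automorphisms to paths of gauge transformations. -/

section GaugeFamilies

open Topology Filter

variable {X : Type*} [TopologicalSpace X] (F : Type*) [NormedAddCommGroup F] [NormedSpace ℝ F]
  (E : X → Type*) [TopologicalSpace (TotalSpace F E)]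
  [∀ x, AddCommGroup (E x)] [∀ x, Module ℝ (E x)] [∀ x, TopologicalSpace (E x)]
  [FiberBundle F E] [VectorBundle ℝ F E]

open Classical in
/-- The preferred trivialization at `x₀`, restricted to the fibre over `x`; outside of its base set
the preferred trivialization at `x` is used instead. -/
noncomputable def fiberChart (x₀ x : X) : E x ≃L[ℝ] F :=
  if h : x ∈ (trivializationAt F E x₀).baseSet then
    (trivializationAt F E x₀).continuousLinearEquivAt ℝ x h
  else (trivializationAt F E x).continuousLinearEquivAt ℝ x (mem_baseSet_trivializationAt F E x)

variable {F E}

theorem fiberChart_apply {x₀ x : X} (h : x ∈ (trivializationAt F E x₀).baseSet) (v : E x) :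
    fiberChart F E x₀ x v = (trivializationAt F E x₀ ⟨x, v⟩).2 := by
  rw [fiberChart, dif_pos h]
  rfl

theorem mk_fiberChart_symm {x₀ x : X} (h : x ∈ (trivializationAt F E x₀).baseSet) (v : F) :
    (⟨x, (fiberChart F E x₀ x).symm v⟩ : TotalSpace F E)
      = (trivializationAt F E x₀).toOpenPartialHomeomorph.symm (x, v) := by
  rw [fiberChart, dif_pos h]
  exact (trivializationAt F E x₀).mk_symm h v

theorem continuousAt_mk_fiberChart_symm {x₀ x : X} (h : x ∈ (trivializationAt F E x₀).baseSet)
    (v : F) :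
    ContinuousAt (fun y => (⟨y, (fiberChart F E x₀ y).symm v⟩ : TotalSpace F E)) x := by
  set e := trivializationAt F E x₀
  have h' : ContinuousAt (fun y => e.toOpenPartialHomeomorph.symm (y, v)) x := by
    refine ContinuousAt.comp (f := fun y => (y, v)) (e.toOpenPartialHomeomorph.symm.continuousAt ?_)
      (continuousAt_id.prodMk continuousAt_const)
    change (x, v) ∈ e.target
    rw [e.target_eq]
    exact ⟨h, trivial⟩
  refine h'.congr ?_
  filter_upwards [e.open_baseSet.mem_nhds h] with y hy
  exact (mk_fiberChart_symm hy v).symm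

variable (F) in
/-- An automorphism of the fibre over `x`, read in the preferred trivialization at `x₀`. -/
noncomputable def inChart (x₀ x : X) (M : E x ≃L[ℝ] E x) : F ≃L[ℝ] F :=
  ((fiberChart F E x₀ x).symm.trans M).trans (fiberChart F E x₀ x)

variable (F) in
/-- A family of automorphisms of the fibres of `E` is continuous in the local trivializations. -/
def IsContinuousFamily {T : Type*} [TopologicalSpace T] (M : T → ∀ x, E x ≃L[ℝ] E x) : Prop :=
  ∀ t₀ x₀, ContinuousAt (fun p : T × X => (inChart F x₀ p.2 (M p.1 p.2) : F →L[ℝ] F)) (t₀, x₀)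

variable {T : Type*} [TopologicalSpace T] {M : T → ∀ x, E x ≃L[ℝ] E x}

theorem IsContinuousFamily.symm [CompleteSpace F] (hM : IsContinuousFamily F M) :
    IsContinuousFamily F fun t x => (M t x).symm := by
  intro t₀ x₀
  have h : ∀ p : T × X, (inChart F x₀ p.2 (M p.1 p.2).symm : F →L[ℝ] F)
      = (inChart F x₀ p.2 (M p.1 p.2) : F →L[ℝ] F).inverse := fun p => by
    rw [ContinuousLinearMap.inverse_equiv]
    rfl
  simp only [h]
  exact ContinuousAt.comp (f := fun p : T × X => (inChart F x₀ p.2 (M p.1 p.2) : F →L[ℝ] F))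
    (contDiffAt_map_inverse (n := 0) _).continuousAt (hM t₀ x₀)

theorem IsContinuousFamily.continuous (hM : IsContinuousFamily F M) :
    Continuous fun z : T × TotalSpace F E =>
      (⟨z.2.proj, M z.1 z.2.proj z.2.2⟩ : TotalSpace F E) := by
  rw [continuous_iff_continuousAt]
  rintro ⟨t₀, p₀⟩
  have hproj : ContinuousAt (fun z : T × TotalSpace F E => z.2.proj) (t₀, p₀) :=
    ((FiberBundle.continuous_proj F E).comp continuous_snd).continuousAt
  rw [FiberBundle.continuousAt_totalSpace]
  refine ⟨hproj, ?_⟩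
  dsimp only
  set e := trivializationAt F E p₀.proj
  have hM' : ContinuousAt (fun z : T × TotalSpace F E =>
      (inChart F p₀.proj z.2.proj (M z.1 z.2.proj) : F →L[ℝ] F)) (t₀, p₀) :=
    ContinuousAt.comp (f := fun z : T × TotalSpace F E => (z.1, z.2.proj))
      (g := fun p : T × X => (inChart F p₀.proj p.2 (M p.1 p.2) : F →L[ℝ] F)) (hM t₀ p₀.proj)
      (continuousAt_fst.prodMk hproj)
  have he : ContinuousAt (fun z : T × TotalSpace F E => (e z.2).2) (t₀, p₀) :=
    continuous_snd.continuousAt.comp (ContinuousAt.comp (f := fun z : T × TotalSpace F E => z.2)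
      (e.continuousAt (FiberBundle.mem_trivializationAt_proj_source)) continuousAt_snd)
  refine (hM'.clm_apply he).congr ?_
  filter_upwards [hproj.eventually
    (e.open_baseSet.mem_nhds (mem_baseSet_trivializationAt F E p₀.proj))] with z hz
  rw [← fiberChart_apply hz, ← fiberChart_apply hz]
  simp [inChart]

/-- The gauge transformations defined by a continuous family of fibre automorphisms. -/
noncomputable def IsContinuousFamily.gau [CompleteSpace F] (hM : IsContinuousFamily F M) (t : T) :
    Gau F E :=
  ⟨{ toFun := fun p => ⟨p.proj, M t p.proj p.2⟩
     invFun := fun p => ⟨p.proj, (M t p.proj).symm p.2⟩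
     left_inv := fun p => by simp
     right_inv := fun p => by simp
     continuous_toFun := hM.continuous.comp (Continuous.prodMk_right t)
     continuous_invFun := hM.symm.continuous.comp (Continuous.prodMk_right t) },
    fun x => (M t x).toLinearEquiv, fun _ _ => rfl⟩

theorem IsContinuousFamily.continuous_gau [CompleteSpace F] (hM : IsContinuousFamily F M) :
    Continuous hM.gau :=
  continuous_induced_rng.2 (ContinuousMap.curry ⟨_, hM.continuous⟩).continuous

end GaugeFamilies

/-! ### Invertibility in finite dimension. -/

section InvertibleForms

variable {F : Type*} [NormedAddCommGroup F] [NormedSpace ℝ F] [FiniteDimensional ℝ F]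

theorem isInvertible_of_injective {b : F →L[ℝ] F →L[ℝ] ℝ} (hb : Function.Injective b) :
    b.IsInvertible := by
  have hd : Module.finrank ℝ F = Module.finrank ℝ (F →L[ℝ] ℝ) := by
    rw [← (LinearMap.toContinuousLinearMap : (F →ₗ[ℝ] ℝ) ≃ₗ[ℝ] F →L[ℝ] ℝ).finrank_eq]
    exact Subspace.dual_finrank_eq.symm
  exact ⟨(LinearEquiv.ofInjectiveOfFinrankEq (b : F →ₗ[ℝ] F →L[ℝ] ℝ) hb hd).toContinuousLinearEquiv,
    by ext; rfl⟩

/-- A map pulling some form back to a non-degenerate one has trivial kernel. -/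
theorem isInvertible_formChain {β : ℝ → F →L[ℝ] F →L[ℝ] ℝ} (hβ : ∀ s, (β s).IsInvertible)
    (hs : ∀ s v w, β s v w = β s w v) {δ t : ℝ} (hδ : IsStepWidth β δ)
    (ht : t ∈ Set.Icc (0 : ℝ) 1) (n : ℕ) : (formChain β δ t n).IsInvertible := by
  have hinj : Function.Injective (formChain β δ t n : F →ₗ[ℝ] F) := by
    refine (injective_iff_map_eq_zero _).2 fun v hv => ?_
    refine (injective_iff_map_eq_zero _).1 (hβ (min (n * δ) t)).injective v ?_
    ext w
    rw [← formChain_isometry hβ hs hδ ht]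
    rw [ContinuousLinearMap.coe_coe] at hv
    simp [hv]
  exact ⟨(LinearEquiv.ofInjectiveEndo _ hinj).toContinuousLinearEquiv, by ext; rfl⟩

end InvertibleForms

/-! ### Fibrewise forms read in charts. -/

section FormsInCharts

open Topology Filter

variable {X : Type*} {F : Type*} [NormedAddCommGroup F] [NormedSpace ℝ F] [FiniteDimensional ℝ F]
  {E : X → Type*} [TopologicalSpace (TotalSpace F E)]
  [∀ x, AddCommGroup (E x)] [∀ x, Module ℝ (E x)] [∀ x, TopologicalSpace (E x)]

/-- The bilinear form of `q` on the fibre over `x`, transported to `F`. -/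
noncomputable def formAt (q : QuadNondeg F E) (x : X) (g : E x ≃L[ℝ] F) : F →L[ℝ] F →L[ℝ] ℝ :=
  ((QuadraticMap.associated (R := ℝ) (q.2 x).choose).compl₁₂
    (g.symm : F →ₗ[ℝ] E x) (g.symm : F →ₗ[ℝ] E x)).toContinuousBilinearMap

theorem formAt_apply (q : QuadNondeg F E) (x : X) (g : E x ≃L[ℝ] F) (v w : F) :
    formAt q x g v w = QuadraticMap.associated (R := ℝ) (q.2 x).choose (g.symm v) (g.symm w) := rfl

/-- Polarization removes the chosen quadratic form, so continuity can be read off from `q`. -/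
theorem formAt_apply_eq (q : QuadNondeg F E) (x : X) (g : E x ≃L[ℝ] F) (v w : F) :
    formAt q x g v w = 2⁻¹ * (q.1 ⟨x, g.symm (v + w)⟩ - q.1 ⟨x, g.symm v⟩ - q.1 ⟨x, g.symm w⟩) := by
  obtain ⟨hQ, -⟩ := (q.2 x).choose_spec
  have h := LinearMap.congr_fun₂ (QuadraticMap.two_nsmul_associated ℝ (q.2 x).choose)
    (g.symm v) (g.symm w)
  rw [LinearMap.smul_apply, LinearMap.smul_apply, QuadraticMap.polarBilin_apply_apply,
    QuadraticMap.polar, ← map_add g.symm, ← hQ, ← hQ, ← hQ, nsmul_eq_mul] at h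
  rw [← h, formAt_apply]
  ring

theorem formAt_self (q : QuadNondeg F E) (x : X) (g : E x ≃L[ℝ] F) (v : F) :
    formAt q x g v v = q.1 ⟨x, g.symm v⟩ := by
  rw [formAt_apply, QuadraticMap.associated_eq_self_apply, (q.2 x).choose_spec.1]

theorem formAt_symm (q : QuadNondeg F E) (x : X) (g : E x ≃L[ℝ] F) (v w : F) :
    formAt q x g v w = formAt q x g w v := by
  rw [formAt_apply_eq, formAt_apply_eq, add_comm v w]
  ring

theorem formAt_trans (q : QuadNondeg F E) (x : X) (g : E x ≃L[ℝ] F) (c : F ≃L[ℝ] F) :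
    formAt q x (g.trans c) = formCongr c (formAt q x g) := rfl

theorem isInvertible_formAt (q : QuadNondeg F E) (x : X) (g : E x ≃L[ℝ] F) :
    (formAt q x g).IsInvertible := by
  refine isInvertible_of_injective ((injective_iff_map_eq_zero _).2 fun v hv => ?_)
  have h := (q.2 x).choose_spec.2.1 (g.symm v) fun w => by
    rw [← g.symm_apply_apply w, ← formAt_apply, hv]
    rfl
  simpa using h

/-- A change of chart conjugates the ratio. The norm condition is not invariant under this, but
`sqrtDomain` is. -/
theorem IsStepWidth.formAt_of_equiv {γ : ℝ → QuadNondeg F E} {x : X} {g : E x ≃L[ℝ] F} {δ : ℝ}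
    (h : IsStepWidth (fun s => formAt (γ s) x g) δ) (g' : E x ≃L[ℝ] F) :
    IsStepWidth (fun s => formAt (γ s) x g') δ := by
  have hg : g.trans (g.symm.trans g') = g' := by
    ext
    simp
  refine ⟨h.1, fun s hs u hu => ?_⟩
  dsimp only
  rw [← hg, formAt_trans, formAt_trans, formRatio_formCongr _ (isInvertible_formAt _ _ _)]
  exact map_mem_sqrtDomain _ (h.2 s hs u hu)

end FormsInCharts

/-! ### Lifting paths of forms, and the orbits. -/

section Lifting

open Topology Filter

variable {X : Type*} [TopologicalSpace X] {F : Type*} [NormedAddCommGroup F] [NormedSpace ℝ F]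
  [FiniteDimensional ℝ F] {E : X → Type*} [TopologicalSpace (TotalSpace F E)]
  [∀ x, AddCommGroup (E x)] [∀ x, Module ℝ (E x)] [∀ x, TopologicalSpace (E x)]
  [FiberBundle F E]

theorem continuous_quadNondeg_eval [LocallyCompactSpace X] {γ : ℝ → QuadNondeg F E}
    (hγ : Continuous γ) : Continuous fun z : ℝ × TotalSpace F E => (γ z.1).1 z.2 := by
  have : LocallyCompactSpace (TotalSpace F E) :=
    ChartedSpace.locallyCompactSpace (X × F) (TotalSpace F E)
  have : ProperSpace F := FiniteDimensional.proper ℝ F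
  exact ContinuousMap.continuous_uncurry_of_continuous ⟨_, continuous_subtype_val.comp hγ⟩

variable [VectorBundle ℝ F E]

/-- In the preferred trivialization at `x₀`, a path of forms is jointly continuous. -/
theorem continuousAt_formAt [LocallyCompactSpace X] {γ : ℝ → QuadNondeg F E}
    (hγ : Continuous γ) (x₀ : X) (s : ℝ) :
    ContinuousAt (fun p : X × ℝ => formAt (γ p.2) p.1 (fiberChart F E x₀ p.1)) (x₀, s) := by
  set U := (trivializationAt F E x₀).baseSet
  have hU : IsOpen (U ×ˢ (Set.univ : Set ℝ)) :=
    (trivializationAt F E x₀).open_baseSet.prod isOpen_univ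
  refine ContinuousOn.continuousAt ?_
    (hU.mem_nhds ⟨mem_baseSet_trivializationAt F E x₀, trivial⟩)
  refine continuousOn_clm_apply.2 fun v => continuousOn_clm_apply.2 fun w => ?_
  have h : ∀ v : F, ContinuousOn (fun p : X × ℝ =>
      (γ p.2).1 (⟨p.1, (fiberChart F E x₀ p.1).symm v⟩ : TotalSpace F E)) (U ×ˢ Set.univ) := by
    rintro v ⟨x, s⟩ ⟨hx, -⟩
    refine ContinuousAt.continuousWithinAt ?_
    exact ContinuousAt.comp
      (f := fun p : X × ℝ => (p.2, (⟨p.1, (fiberChart F E x₀ p.1).symm v⟩ : TotalSpace F E)))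
      (continuous_quadNondeg_eval hγ).continuousAt
      (continuousAt_snd.prodMk (ContinuousAt.comp (f := fun p : X × ℝ => p.1)
        (continuousAt_mk_fiberChart_symm hx v) continuousAt_fst))
  simp only [formAt_apply_eq]
  exact continuousOn_const.mul (((h _).sub (h _)).sub (h _))

/-- The ratio is `1` at increment `0`, so by continuity in the fixed chart at `x₀` and compactness
of `[0, 1]` it stays near `1` for small increments, uniformly in time and near `x₀`. -/
theorem eventually_isStepWidth [LocallyCompactSpace X] {γ : ℝ → QuadNondeg F E}
    (hγ : Continuous γ) (x₀ : X) :
    ∃ δ, ∀ᶠ x in 𝓝 x₀, IsStepWidth (fun s => formAt (γ s) x (fiberChart F E x x)) δ := by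
  have key : ∀ s ∈ Set.Icc (0 : ℝ) 1, ∀ᶠ z : (X × ℝ) × ℝ in 𝓝 ((x₀, 0), s),
      ‖1 - formRatio (formAt (γ z.2) z.1.1 (fiberChart F E x₀ z.1.1))
        (formAt (γ (z.2 + z.1.2)) z.1.1 (fiberChart F E x₀ z.1.1))‖ < 1 := by
    intro s _
    have h₁ : ContinuousAt (fun z : (X × ℝ) × ℝ =>
        formAt (γ z.2) z.1.1 (fiberChart F E x₀ z.1.1)) ((x₀, 0), s) :=
      ContinuousAt.comp (f := fun z : (X × ℝ) × ℝ => (z.1.1, z.2))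
        (g := fun p : X × ℝ => formAt (γ p.2) p.1 (fiberChart F E x₀ p.1))
        (continuousAt_formAt hγ x₀ s) (by fun_prop)
    have h₂ : ContinuousAt (fun z : (X × ℝ) × ℝ =>
        formAt (γ (z.2 + z.1.2)) z.1.1 (fiberChart F E x₀ z.1.1)) ((x₀, 0), s) :=
      ContinuousAt.comp (f := fun z : (X × ℝ) × ℝ => (z.1.1, z.2 + z.1.2))
        (g := fun p : X × ℝ => formAt (γ p.2) p.1 (fiberChart F E x₀ p.1))
        (continuousAt_formAt hγ x₀ _) (by fun_prop)
    have h₃ := ((continuousAt_const (y := (1 : F →L[ℝ] F))).sub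
      (continuousAt_formRatio h₁ h₂ (isInvertible_formAt _ _ _))).norm
    refine h₃.eventually_lt (continuousAt_const (y := (1 : ℝ))) ?_
    simp [formRatio_self (isInvertible_formAt (γ s) x₀ (fiberChart F E x₀ x₀))]
  obtain ⟨P, hP, Q, hQ, hPQ⟩ := eventually_prod_iff.1
    (nhds_prod_eq (x := x₀) (y := (0 : ℝ)) ▸
      isCompact_Icc.eventually_forall_of_forall_eventually
        (P := fun (p : X × ℝ) s => ‖1 - formRatio (formAt (γ s) p.1 (fiberChart F E x₀ p.1))
          (formAt (γ (s + p.2)) p.1 (fiberChart F E x₀ p.1))‖ < 1) key)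
  obtain ⟨ε, hε, hball⟩ := Metric.eventually_nhds_iff.1 hQ
  refine ⟨ε / 2, hP.mono fun x hx => IsStepWidth.formAt_of_equiv (g := fiberChart F E x₀ x)
    ⟨half_pos hε, fun s hs u hu => ?_⟩ _⟩
  refine mem_sqrtDomain_of_norm_lt (hPQ hx (hball ?_) s hs)
  rw [Real.dist_0_eq_abs, abs_of_nonneg hu.1]
  linarith [hu.2]

/-- The step widths at a point form an interval, hence a convex set, so local constants can be glued
by a partition of unity. -/
theorem exists_continuous_isStepWidth [T2Space X] [ParacompactSpace X] [LocallyCompactSpace X]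
    {γ : ℝ → QuadNondeg F E} (hγ : Continuous γ) :
    ∃ δ : C(X, ℝ), ∀ x, IsStepWidth (fun s => formAt (γ s) x (fiberChart F E x x)) (δ x) := by
  refine exists_continuous_forall_mem_convex_of_local_const
    (t := fun x => {δ | IsStepWidth (fun s => formAt (γ s) x (fiberChart F E x x)) δ})
    (fun x => Set.OrdConnected.convex ⟨fun δ hδ δ' hδ' η hη => ⟨hδ.1.trans_le hη.1, ?_⟩⟩)
    (eventually_isStepWidth hγ)
  exact fun s hs u hu => hδ'.2 s hs u ⟨hu.1, hu.2.trans hη.2⟩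

/-- The products `formChain` do not depend on the trivialization in which they are formed. -/
theorem inChart_formChain {γ : ℝ → QuadNondeg F E} (x₀ x : X) {δ t : ℝ} {n : ℕ} {c : F ≃L[ℝ] F}
    (hc : (c : F →L[ℝ] F) = formChain (fun s => formAt (γ s) x (fiberChart F E x x)) δ t n) :
    (inChart F x₀ x (((fiberChart F E x x).trans c).trans (fiberChart F E x x).symm) : F →L[ℝ] F)
      = formChain (fun s => formAt (γ s) x (fiberChart F E x₀ x)) δ t n := by
  set d := (fiberChart F E x x).symm.trans (fiberChart F E x₀ x) with hd
  have hg : (fiberChart F E x x).trans d = fiberChart F E x₀ x := by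
    ext
    simp [hd]
  have h : formChain (fun s => formAt (γ s) x (fiberChart F E x₀ x)) δ t n
      = d.conjContinuousAlgEquiv c := by
    rw [hc, ← formChain_formCongr _ fun s => isInvertible_formAt (γ s) x _, ← hg]
    simp only [formAt_trans]
  rw [h]
  ext v
  simp [inChart, hd]

/-- A path of forms lifts to a path of gauge transformations. -/
theorem exists_continuous_gau [T2Space X] [ParacompactSpace X] [LocallyCompactSpace X]
    {γ : ℝ → QuadNondeg F E} (hγ : Continuous γ) :
    ∃ Φ : unitInterval → Gau F E, Continuous Φ ∧ Φ 0 = 1 ∧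
      ∀ t : unitInterval, QuadNondeg.pullback (Φ t) (γ 0) = γ t := by
  obtain ⟨δ, hδ⟩ := exists_continuous_isStepWidth hγ
  have hinv : ∀ x (g : E x ≃L[ℝ] F) s, (formAt (γ s) x g).IsInvertible := fun x g s =>
    isInvertible_formAt _ _ _
  have hsymm : ∀ x (g : E x ≃L[ℝ] F) s v w, formAt (γ s) x g v w = formAt (γ s) x g w v :=
    fun x g s => formAt_symm _ _ _
  choose C hC using fun (t : unitInterval) (x : X) => isInvertible_formChain
    (hinv x (fiberChart F E x x)) (hsymm x _) (hδ x) t.2 ⌈1 / δ x⌉₊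
  let M : unitInterval → ∀ x, E x ≃L[ℝ] E x := fun t x =>
    ((fiberChart F E x x).trans (C t x)).trans (fiberChart F E x x).symm
  have hM : IsContinuousFamily F M := by
    intro t₀ x₀
    simp only [M, fun (t : unitInterval) x => inChart_formChain x₀ x (hC t x)]
    refine continuousAt_formChain_ceil (Y := unitInterval × X)
      (β := fun p s => formAt (γ s) p.2 (fiberChart F E x₀ p.2)) (δ := fun p => δ p.2)
      (t := fun p => p.1) (fun s => ?_) (by fun_prop) (by fun_prop) (fun p => hinv p.2 _)
      (fun p => (hδ p.2).formAt_of_equiv _) (fun p => p.1.2)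
    exact ContinuousAt.comp (f := fun z : (unitInterval × X) × ℝ => (z.1.2, z.2))
      (g := fun p : X × ℝ => formAt (γ p.2) p.1 (fiberChart F E x₀ p.1))
      (continuousAt_formAt hγ x₀ s) (by fun_prop)
  refine ⟨hM.gau, hM.continuous_gau, ?_, fun t => ?_⟩
  · have h₁ : ∀ x v, M 0 x v = v := by
      intro x v
      have h := hC 0 x
      rw [Set.Icc.coe_zero, formChain_zero (hinv x _) (hδ x).1.le] at h
      have h' := DFunLike.congr_fun h (fiberChart F E x x v)
      rw [ContinuousLinearEquiv.coe_coe] at h'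
      simp [M, h']
    refine Subtype.ext (Homeomorph.ext fun p => ?_)
    change (⟨p.proj, M 0 p.proj p.2⟩ : TotalSpace F E) = p
    rw [h₁]
  · refine Subtype.ext (ContinuousMap.ext fun p => ?_)
    obtain ⟨x, v⟩ := p
    change (γ 0).1 ⟨x, M t x v⟩ = (γ t).1 ⟨x, v⟩
    have h := formChain_isometry (hinv x (fiberChart F E x x)) (hsymm x _) (hδ x) t.2
      ⌈1 / δ x⌉₊ (fiberChart F E x x v) (fiberChart F E x x v)
    -- `⌈1/δ⌉` steps reach time `1`, so the clamped endpoint is `t`.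
    rw [min_eq_right (t.2.2.trans (one_le_ceil_mul (hδ x).1)), formAt_self, formAt_self, ← hC] at h
    simpa [M] using h

theorem orbit_gauZero_eq_pathComponent [T2Space X] [ParacompactSpace X] [LocallyCompactSpace X]
    (q : QuadNondeg F E) : MulAction.orbit (GauZero F E).op q = pathComponent q := by
  ext q'
  constructor
  · rintro ⟨φ, rfl⟩
    have hφ : Joined 1 (MulOpposite.unop φ.1) := φ.2
    have hc : Continuous fun φ : Gau F E => QuadNondeg.pullback φ q :=
      continuous_induced_rng.2
        ((ContinuousMap.continuous_postcomp q.1).comp continuous_induced_dom)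
    exact hφ.map hc
  · rintro ⟨γ⟩
    obtain ⟨Φ, hΦ, hΦ0, hpull⟩ := exists_continuous_gau γ.continuous_extend
    have hmem : Φ 1 ∈ GauZero F E := by
      change Joined 1 (Φ 1)
      exact ⟨⟨⟨Φ, hΦ⟩, hΦ0, rfl⟩⟩
    refine ⟨⟨MulOpposite.op (Φ 1), hmem⟩, ?_⟩
    have h := hpull 1
    rw [γ.extend_zero, Set.Icc.coe_one, γ.extend_one] at h
    exact h

end Lifting

theorem corollary3p12
    {X : Type*} [TopologicalSpace X] [T2Space X] [ParacompactSpace X] [ConnectedSpace X]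
    [LocallyConnectedSpace X] [LocallyCompactSpace X]
    (F : Type*) [NormedAddCommGroup F] [NormedSpace ℝ F] [FiniteDimensional ℝ F]
    (E : X → Type*) [TopologicalSpace (TotalSpace F E)]
    [∀ x, AddCommGroup (E x)] [∀ x, Module ℝ (E x)] [∀ x, TopologicalSpace (E x)]
    [FiberBundle F E] [VectorBundle ℝ F E] :
    (∀ q : QuadNondeg F E, MulAction.orbit (GauZero F E).op q = pathComponent q) ∧
    (∀ q : QuadNondeg F E, ∃ C : Set (Set (QuadNondeg F E)),
      (∀ S ∈ C, ∃ q' : QuadNondeg F E, S = pathComponent q') ∧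
      C.PairwiseDisjoint id ∧
      MulAction.orbit (Gau F E)ᵐᵒᵖ q = ⋃₀ C) := by
  refine ⟨orbit_gauZero_eq_pathComponent, fun q =>
    ⟨pathComponent '' MulAction.orbit (Gau F E)ᵐᵒᵖ q, ?_, ?_, ?_⟩⟩
  · rintro _ ⟨q', -, rfl⟩
    exact ⟨q', rfl⟩
  · rintro _ ⟨q₁, -, rfl⟩ _ ⟨q₂, -, rfl⟩ hne
    refine Set.disjoint_left.2 fun p h₁ h₂ => hne ?_
    exact (pathComponent_congr h₁).symm.trans (pathComponent_congr h₂)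
  · refine Set.Subset.antisymm (fun p hp => ⟨_, ⟨p, hp, rfl⟩, mem_pathComponent_self p⟩) ?_
    -- The path component of `q'` is its `Gau₀`-orbit, which stays inside the `Gau`-orbit.
    rintro p ⟨_, ⟨q', hq', rfl⟩, hp⟩
    rw [← orbit_gauZero_eq_pathComponent] at hp
    obtain ⟨φ, rfl⟩ := hp
    exact (MulAction.orbit_eq_iff.2 hq') ▸ MulAction.mem_orbit q' φ.1
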